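/- Let $\hat{\mathbb C}=\mathbb C\cup\{\infty\}$ be the extended complex plane. A Möbius transformation is a map $f:\hat{\mathbb C}\to\hat{\mathbb C}$ of the form $f(z)=\frac{az+b}{cz+d}$ with $a,b,c,d\in\mathbb C$ and $ad-bc\ne 0$. Two Möbius transformations $f,g$ are called conjugate if $g=h^{-1}\circ f\circ h$ for some Möbius transformation $h$, and topologically conjugate if $g=h^{-1}\circ f\circ h$ for some homeomorphism $h:\hat{\mathbb C}\to\hat{\mathbb C}$. A Möbius transformation is called hyperbolic if it is conjugate to $z\mapsto\mu z$ for some real $\mu\notin\{0,1,-1\}$; loxodromic if it is conjugate to $z\mapsto\mu z$ for some $\mu\in\mathbb C\setminus\mathbb R$ with $|\mu|\ne 1$; elliptic if it is conjugate to $z\mapsto\mu z$ for some $\mu\in\mathbb C$ with $|\mu|=1$ and $\mu\ne 1$; parabolic if it is conjugate to $z\mapsto z+1$. (a) Each hyperbolic or loxodromic Möbius transformation is topologically conjugate to $z\mapsto 2z$. (b) Each elliptic Möbius transformation is topologically conjugate to $z\mapsto\mu z$ for some $\mu\in\mathbb C$ with $|\mu|=1$, and $\mu$ is uniquely determined up to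 replacement by $\bar\mu$: for every $\nu\in\mathbb C$ with $|\nu|=1$, the transformation is topologically conjugate to $z\mapsto\nu z$ if and only if $\nu=\mu$ or $\nu=\bar\mu$. (c) Each parabolic Möbius transformation is topologically conjugate to $z\mapsto z+1$. -/

import Mathlib

/-- A Möbius transformation of the extended complex plane `ℂ ∪ {∞}` (the one-point
compactification of `ℂ`): a map `z ↦ (a z + b) / (c z + d)` with `a d - b c ≠ 0`, that is, the
action of some invertible matrix `!![a, b; c, d]` by linear fractional transformations. -/
def IsMobius (f : OnePoint ℂ → OnePoint ℂ) : Prop :=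
  ∃ m : GL (Fin 2) ℂ, ∀ z, f z = m • z

/-- `f` and `g` are conjugate: `g = h⁻¹ ∘ f ∘ h` for some Möbius transformation `h`. -/
def MobiusConj (f g : OnePoint ℂ → OnePoint ℂ) : Prop :=
  ∃ h : GL (Fin 2) ℂ, ∀ z, g z = h⁻¹ • f (h • z)

/-- `f` and `g` are topologically conjugate: `g = h⁻¹ ∘ f ∘ h` for some homeomorphism `h` of the
extended complex plane. -/
def TopConj (f g : OnePoint ℂ → OnePoint ℂ) : Prop :=
  ∃ h : OnePoint ℂ ≃ₜ OnePoint ℂ, ∀ z, g z = h.symm (f (h z))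

/-- The map `z ↦ μ z`, with `∞ ↦ ∞` (used for `μ ≠ 0`). -/
def scaling (μ : ℂ) : OnePoint ℂ → OnePoint ℂ :=
  OnePoint.map fun z : ℂ => μ * z

/-- The map `z ↦ z + 1`, with `∞ ↦ ∞`. -/
def shift : OnePoint ℂ → OnePoint ℂ :=
  OnePoint.map fun z : ℂ => z + 1

/-- Hyperbolic: conjugate to `z ↦ μ z` with `μ` real, `μ ≠ 0, 1, -1`. The value `-1` belongs to
the elliptic class. -/
def IsHyperbolic (f : OnePoint ℂ → OnePoint ℂ) : Prop :=
  ∃ μ : ℝ, μ ≠ 0 ∧ μ ≠ 1 ∧ μ ≠ -1 ∧ MobiusConj f (scaling (μ : ℂ))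

/-- Loxodromic: conjugate to `z ↦ μ z` with `μ` not real and `|μ| ≠ 1`. -/
def IsLoxodromic (f : OnePoint ℂ → OnePoint ℂ) : Prop :=
  ∃ μ : ℂ, μ ∉ Set.range ((↑) : ℝ → ℂ) ∧ ‖μ‖ ≠ 1 ∧ MobiusConj f (scaling μ)

/-- Elliptic: conjugate to `z ↦ μ z` with `|μ| = 1` and `μ ≠ 1`. -/
def IsElliptic (f : OnePoint ℂ → OnePoint ℂ) : Prop :=
  ∃ μ : ℂ, ‖μ‖ = 1 ∧ μ ≠ 1 ∧ MobiusConj f (scaling μ)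

/-- Parabolic: conjugate to `z ↦ z + 1`. -/
def IsParabolic (f : OnePoint ℂ → OnePoint ℂ) : Prop :=
  MobiusConj f shift

open Filter Topology Complex OnePoint

/-! ### Topological conjugacy is an equivalence relation -/

/-! Möbius maps are homeomorphisms, so only the normal forms need comparing, and the parabolic case
is immediate. If `|μ| > 1`, the map `z ↦ z|z|^c` with `2 · 2^c = μ` carries doubling to `z ↦ μz`;
inversion handles `|μ| < 1`.

For rotations, complex conjugation realises `μ ↦ μ̄`. Conversely, a conjugating homeomorphism sends
`{0, ∞}` to itself and, after an inversion if needed, fixes both points. It then lifts through `exp`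
to some `H` with `H(z + 2πi) = H(z) + 2πi·d`, where `d = ±1` (`degree_eq_one_or_neg_one`). If `ν =
exp(iα)`, then `H(z + iα) = H(z) + c` with `exp c = μ`, and boundedness forces `c = d·iα`
(`translation_eq_of_degree`), so `μ = ν^d`. -/

theorem TopConj.of_semiconj {f g : OnePoint ℂ → OnePoint ℂ} (h : OnePoint ℂ ≃ₜ OnePoint ℂ)
    (hh : ∀ z, h (g z) = f (h z)) : TopConj f g :=
  ⟨h, fun z => by rw [← hh, h.symm_apply_apply]⟩

theorem TopConj.symm {f g : OnePoint ℂ → OnePoint ℂ} (h : TopConj f g) : TopConj g f := by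
  obtain ⟨h, hh⟩ := h
  exact ⟨h.symm, fun z => by simp [hh]⟩

theorem TopConj.trans {f g k : OnePoint ℂ → OnePoint ℂ} (h₁ : TopConj f g) (h₂ : TopConj g k) :
    TopConj f k := by
  obtain ⟨h₁, hh₁⟩ := h₁
  obtain ⟨h₂, hh₂⟩ := h₂
  exact ⟨h₂.trans h₁, fun z => by simp [hh₁, hh₂]⟩

/-! ### Möbius transformations are homeomorphisms -/

/-- The inversion `z ↦ 1 / z` of the extended complex plane. -/
noncomputable def sphereInv (z : OnePoint ℂ) : OnePoint ℂ :=
  z.elim ((0 : ℂ) : OnePoint ℂ) fun w => if w = 0 then ∞ else ((w⁻¹ : ℂ) : OnePoint ℂ)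

@[simp] theorem sphereInv_infty : sphereInv ∞ = ((0 : ℂ) : OnePoint ℂ) := rfl

@[simp] theorem sphereInv_zero : sphereInv ((0 : ℂ) : OnePoint ℂ) = ∞ := by
  simp [sphereInv]

theorem sphereInv_coe {w : ℂ} (hw : w ≠ 0) : sphereInv w = ((w⁻¹ : ℂ) : OnePoint ℂ) := by
  simp [sphereInv, hw]

theorem sphereInv_sphereInv (z : OnePoint ℂ) : sphereInv (sphereInv z) = z := by
  induction z using OnePoint.rec with
  | infty => simp
  | coe w =>
    by_cases hw : w = 0
    · simp [hw]
    · rw [sphereInv_coe hw, sphereInv_coe (inv_ne_zero hw), inv_inv]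

theorem continuous_sphereInv : Continuous sphereInv := by
  rw [continuous_iff_continuousAt]
  intro z
  induction z using OnePoint.rec with
  | infty =>
    rw [continuousAt_infty', sphereInv_infty, coclosedCompact_eq_cocompact,
      ← Metric.cobounded_eq_cocompact]
    have h : Tendsto (fun w : ℂ => ((w⁻¹ : ℂ) : OnePoint ℂ)) (Bornology.cobounded ℂ)
        (𝓝 ((0 : ℂ) : OnePoint ℂ)) :=
      (continuous_coe.tendsto 0).comp tendsto_inv₀_cobounded
    refine h.congr' ?_
    filter_upwards [Bornology.eventually_ne_cobounded (0 : ℂ)] with w hw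
    exact (sphereInv_coe hw).symm
  | coe w =>
    rw [continuousAt_coe]
    by_cases hw : w = 0
    · subst hw
      rw [continuousAt_iff_punctured_nhds, Function.comp_apply, sphereInv_zero]
      have h : Tendsto (fun w : ℂ => ((w⁻¹ : ℂ) : OnePoint ℂ)) (𝓝[≠] 0) (𝓝 ∞) := by
        refine (tendsto_coe_infty (X := ℂ)).comp ?_
        rw [coclosedCompact_eq_cocompact, ← Metric.cobounded_eq_cocompact]
        exact tendsto_inv₀_nhdsNE_zero
      refine h.congr' ?_
      filter_upwards [self_mem_nhdsWithin] with w hw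
      exact (sphereInv_coe hw).symm
    · have h : ContinuousAt (fun w : ℂ => ((w⁻¹ : ℂ) : OnePoint ℂ)) w :=
        continuous_coe.continuousAt.comp (continuousAt_inv₀ hw)
      refine h.congr ?_
      filter_upwards [eventually_ne_nhds hw] with w hw
      exact (sphereInv_coe hw).symm

/-- The inversion `z ↦ 1 / z` as a homeomorphism of the extended complex plane. -/
noncomputable def sphereInvHomeomorph : OnePoint ℂ ≃ₜ OnePoint ℂ where
  toFun := sphereInv
  invFun := sphereInv
  left_inv := sphereInv_sphereInv
  right_inv := sphereInv_sphereInv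
  continuous_toFun := continuous_sphereInv
  continuous_invFun := continuous_sphereInv

@[simp] theorem sphereInvHomeomorph_apply (z : OnePoint ℂ) :
    sphereInvHomeomorph z = sphereInv z := rfl

theorem continuous_map_affine {a : ℂ} (ha : a ≠ 0) (b : ℂ) :
    Continuous (OnePoint.map fun z : ℂ => a * z + b) :=
  ((Homeomorph.mulLeft₀ a ha).trans (Homeomorph.addRight b)).onePointCongr.continuous

theorem continuous_gl_smul (g : GL (Fin 2) ℂ) : Continuous fun z : OnePoint ℂ => g • z := by
  have hdet : g 0 0 * g 1 1 - g 0 1 * g 1 0 ≠ 0 := by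
    rw [← Matrix.det_fin_two]
    exact g.det_ne_zero
  by_cases hc : g 1 0 = 0
  · have ha : g 0 0 ≠ 0 := by rintro h; simp [h, hc] at hdet
    have hd : g 1 1 ≠ 0 := by rintro h; simp [h, hc] at hdet
    convert continuous_map_affine (div_ne_zero ha hd) (g 0 1 / g 1 1) using 2 with z
    induction z using OnePoint.rec with
    | infty => simp [smul_infty_eq_ite, hc]
    | coe w =>
      simp only [smul_some_eq_ite, hc, hd, map_some, zero_mul, zero_add, if_false]
      congr 1
      field_simp
  -- Partial fractions: `(az + b)/(cz + d) = a/c - ((ad - bc)/c) · 1/(cz + d)`, an affine map, the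
  -- inversion and another affine map.
  · have hk : -(g 0 0 * g 1 1 - g 0 1 * g 1 0) / g 1 0 ≠ 0 := div_ne_zero (neg_ne_zero.2 hdet) hc
    convert (continuous_map_affine hk (g 0 0 / g 1 0)).comp
      (continuous_sphereInv.comp (continuous_map_affine hc (g 1 1))) using 2 with z
    induction z using OnePoint.rec with
    | infty => simp [smul_infty_eq_ite, hc]
    | coe w =>
      by_cases hw : g 1 0 * w + g 1 1 = 0
      · simp [smul_some_eq_ite, hw]
      · simp only [smul_some_eq_ite, hw, if_false, Function.comp_apply, map_some,
          sphereInv_coe hw]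
        rw [OnePoint.coe_eq_coe, div_eq_iff hw, add_mul, mul_assoc, inv_mul_cancel₀ hw]
        field_simp
        ring

theorem MobiusConj.topConj {f g : OnePoint ℂ → OnePoint ℂ} (h : MobiusConj f g) :
    TopConj f g := by
  obtain ⟨m, hm⟩ := h
  exact ⟨{ MulAction.toPerm m with
    continuous_toFun := continuous_gl_smul m
    continuous_invFun := continuous_gl_smul m⁻¹ }, hm⟩

/-! ### Conjugacies between scalings -/

theorem sphereInv_scaling {μ : ℂ} (hμ : μ ≠ 0) (z : OnePoint ℂ) :
    sphereInv (scaling μ z) = scaling μ⁻¹ (sphereInv z) := by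
  induction z using OnePoint.rec with
  | infty => simp [scaling]
  | coe w =>
    by_cases hw : w = 0
    · simp [scaling, hw]
    · simp [scaling, sphereInv_coe hw, sphereInv_coe (mul_ne_zero hμ hw), mul_comm]

theorem topConj_scaling_inv {μ : ℂ} (hμ : μ ≠ 0) : TopConj (scaling μ⁻¹) (scaling μ) :=
  .of_semiconj sphereInvHomeomorph (sphereInv_scaling hμ)

theorem topConj_scaling_of_semiconj {μ ν : ℂ} (k : ℂ ≃ₜ ℂ) (hk : ∀ z, k (ν * z) = μ * k z) :
    TopConj (scaling μ) (scaling ν) := by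
  refine .of_semiconj k.onePointCongr fun z => ?_
  induction z using OnePoint.rec with
  | infty => rfl
  | coe w => exact congrArg OnePoint.some (hk w)

theorem topConj_scaling_conj (μ : ℂ) :
    TopConj (scaling μ) (scaling ((starRingEnd ℂ) μ)) :=
  topConj_scaling_of_semiconj conjCLE.toHomeomorph fun z => by simp

/-- The map `z ↦ z · |z| ^ c`, fixing `0`. -/
noncomputable def spiral (c z : ℂ) : ℂ := z * exp (c * Real.log ‖z‖)

theorem norm_spiral {c : ℂ} (hc : 0 < 1 + c.re) (z : ℂ) :
    ‖spiral c z‖ = ‖z‖ ^ (1 + c.re) := by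
  by_cases hz : z = 0
  · simp [hz, spiral, Real.zero_rpow hc.ne']
  · have : 0 < ‖z‖ := norm_pos_iff.2 hz
    rw [spiral, norm_mul, norm_exp, re_mul_ofReal, Real.rpow_add this, Real.rpow_one,
      Real.rpow_def_of_pos this, mul_comm c.re]

theorem continuous_spiral {c : ℂ} (hc : 0 < 1 + c.re) : Continuous (spiral c) := by
  rw [continuous_iff_continuousAt]
  intro z
  by_cases hz : z = 0
  · subst hz
    have h0 : spiral c 0 = 0 := by simp [spiral]
    rw [ContinuousAt, h0, tendsto_zero_iff_norm_tendsto_zero]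
    simp only [norm_spiral hc]
    have : Continuous fun z : ℂ => ‖z‖ ^ (1 + c.re) :=
      continuous_norm.rpow_const fun _ => Or.inr hc.le
    simpa [Real.zero_rpow hc.ne'] using this.tendsto 0
  · have hl : ContinuousAt (fun z : ℂ => Real.log ‖z‖) z :=
      continuous_norm.continuousAt.log (norm_ne_zero_iff.2 hz)
    exact continuousAt_id.mul (continuous_exp.continuousAt.comp
      (continuousAt_const.mul (continuous_ofReal.continuousAt.comp hl)))

/-- In the coordinate `w = log z` the map is `w ↦ w + c · Re w`, so the composite adds `(c + c'(1 +
Re c)) · Re w`. -/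
theorem spiral_spiral {c c' : ℂ} (hc : 0 < 1 + c.re) (h : c + c' * (1 + c.re) = 0) (z : ℂ) :
    spiral c' (spiral c z) = z := by
  by_cases hz : z = 0
  · simp [spiral, hz]
  · rw [spiral, norm_spiral hc, Real.log_rpow (norm_pos_iff.2 hz), spiral, mul_assoc, ← exp_add]
    have : c * Real.log ‖z‖ + c' * ((1 + c.re) * Real.log ‖z‖ : ℝ) = 0 := by
      push_cast
      linear_combination (Real.log ‖z‖ : ℂ) * h
    rw [this, exp_zero, mul_one]

/-- The map `z ↦ z · |z| ^ c` as a homeomorphism of the plane. -/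
noncomputable def spiralHomeomorph (c : ℂ) (hc : 0 < 1 + c.re) : ℂ ≃ₜ ℂ :=
  have hne : (1 + c.re : ℂ) ≠ 0 := by exact_mod_cast hc.ne'
  have hre : 1 + (-c / (1 + c.re)).re = (1 + c.re)⁻¹ := by
    have : (-c / (1 + c.re)) = -c / ((1 + c.re : ℝ) : ℂ) := by push_cast; rfl
    rw [this, div_ofReal_re, neg_re]
    field_simp
    ring
  have hc' : 0 < 1 + (-c / (1 + c.re)).re := by rw [hre]; exact inv_pos.2 hc
  { toFun := spiral c
    invFun := spiral (-c / (1 + c.re))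
    left_inv := spiral_spiral hc (by field_simp; ring)
    right_inv := spiral_spiral hc' (by
      have : (1 : ℂ) + ((-c / (1 + c.re)).re : ℝ) = ((1 : ℂ) + c.re)⁻¹ := by
        exact_mod_cast congrArg ofReal hre
      rw [this]
      field_simp
      ring)
    continuous_toFun := continuous_spiral hc
    continuous_invFun := continuous_spiral hc' }

theorem topConj_scaling_two_of_one_lt {μ : ℂ} (hμ : 1 < ‖μ‖) :
    TopConj (scaling μ) (scaling 2) := by
  have hμ0 : μ ≠ 0 := norm_pos_iff.1 (one_pos.trans hμ)
  have hl : 0 < Real.log 2 := Real.log_pos one_lt_two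
  have hl' : (Real.log 2 : ℂ) ≠ 0 := by exact_mod_cast hl.ne'
  -- The exponent solves `2 · 2^c = μ`, and `1 + Re c = log|μ| / log 2`.
  have hc : 0 < 1 + (log μ / Real.log 2 - 1).re := by
    rw [sub_re, div_ofReal_re, log_re, one_re]
    have := div_pos (Real.log_pos hμ) hl
    linarith
  refine topConj_scaling_of_semiconj (spiralHomeomorph _ hc) fun z => ?_
  change spiral _ _ = μ * spiral _ _
  by_cases hz : z = 0
  · simp [hz, spiral]
  have hlog : (Real.log ‖2 * z‖ : ℂ) = Real.log 2 + Real.log ‖z‖ := by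
    rw [norm_mul, Complex.norm_ofNat, Real.log_mul two_ne_zero (norm_ne_zero_iff.2 hz)]
    push_cast
    rfl
  have hexp : exp ((log μ / Real.log 2 - 1) * Real.log 2) = μ / 2 := by
    rw [sub_mul, div_mul_cancel₀ _ hl', one_mul, exp_sub, exp_log hμ0, ← ofReal_exp,
      Real.exp_log two_pos]
    simp
  rw [spiral, hlog, mul_add, exp_add, hexp, spiral]
  ring

theorem topConj_scaling_two {μ : ℂ} (hμ : μ ≠ 0) (hμ1 : ‖μ‖ ≠ 1) :
    TopConj (scaling μ) (scaling 2) := by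
  rcases hμ1.lt_or_gt with h | h
  · exact (topConj_scaling_inv hμ).symm.trans <| topConj_scaling_two_of_one_lt <| by
      rw [norm_inv]
      exact (one_lt_inv₀ (norm_pos_iff.2 hμ)).2 h
  · exact topConj_scaling_two_of_one_lt h

/-! ### The rotation angle is a topological invariant up to sign -/

/-- Two lifts through the covering `exp` that agree at one point of the connected plane agree
everywhere. -/
theorem exists_eq_add_of_exp_eq {F G : ℂ → ℂ} (hF : Continuous F) (hG : Continuous G)
    (h : ∀ z, exp (F z) = exp (G z)) :
    ∃ n : ℤ, ∀ z, F z = G z + n * (2 * Real.pi * I) := by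
  obtain ⟨n, hn⟩ := exp_eq_exp_iff_exists_int.1 (h 0)
  refine ⟨n, fun z => congrFun (isCoveringMap_exp.eq_of_comp_eq hF
    (hG.add continuous_const) (funext fun z => Subtype.ext ?_) 0 hn) z⟩
  simp [h, exp_add, exp_int_mul_two_pi_mul_I]

theorem exists_lift_exp {k : ℂ → ℂ} (hk : Continuous k) (hk0 : ∀ z, z ≠ 0 → k z ≠ 0) :
    ∃ H : ℂ → ℂ, Continuous H ∧ ∀ z, exp (H z) = k (exp z) := by
  have hne : ∀ z, k (exp z) ≠ 0 := fun z => hk0 _ (exp_ne_zero z)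
  obtain ⟨H, ⟨-, hH⟩, -⟩ := isCoveringMapOn_exp.existsUnique_continuousMap_lifts
    (⟨fun z => k (exp z), hk.comp continuous_exp⟩ : C(ℂ, ℂ)) (a₀ := 0) (e₀ := log (k (exp 0)))
    (exp_log (hne 0)) hne
  exact ⟨H, H.continuous, congrFun hH⟩

/-- The map induced on the deck group by the lift of a self-map of the punctured plane. -/
theorem exists_degree {k H : ℂ → ℂ} (hH : Continuous H) (h : ∀ z, exp (H z) = k (exp z)) :
    ∃ d : ℤ, ∀ z, H (z + 2 * Real.pi * I) = H z + d * (2 * Real.pi * I) :=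
  exists_eq_add_of_exp_eq (F := fun z => H (z + 2 * Real.pi * I)) (by fun_prop) hH fun z => by
    rw [h, h, exp_periodic]

theorem add_int_mul_of_add {H : ℂ → ℂ} {p q : ℂ} (h : ∀ z, H (z + p) = H z + q) (n : ℤ) (z : ℂ) :
    H (z + n * p) = H z + n * q := by
  induction n with
  | zero => simp
  | succ n ih =>
    push_cast at ih ⊢
    rw [add_mul, one_mul, ← add_assoc, h, ih]
    ring
  | pred n ih =>
    have := h (z + ((-n - 1 : ℤ) : ℂ) * p)
    push_cast at ih this ⊢
    rw [show z + (-n - 1) * p + p = z + -n * p by ring, ih] at this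
    linear_combination -this

/-- If `H'` lifts `k'` with degree `d'`, then `H' ∘ H` lifts the identity and so is a translation;
hence `d * d' = 1`. -/
theorem degree_eq_one_or_neg_one {k k' H : ℂ → ℂ} (hk' : Continuous k')
    (hk'0 : ∀ z, z ≠ 0 → k' z ≠ 0) (hinv : ∀ z, k' (k z) = z) (hH : Continuous H)
    (h : ∀ z, exp (H z) = k (exp z)) {d : ℤ}
    (hd : ∀ z, H (z + 2 * Real.pi * I) = H z + d * (2 * Real.pi * I)) :
    d = 1 ∨ d = -1 := by
  obtain ⟨H', hH', h'⟩ := exists_lift_exp hk' hk'0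
  obtain ⟨d', hd'⟩ := exists_degree hH' h'
  obtain ⟨n, hn⟩ := exists_eq_add_of_exp_eq (hH'.comp hH) continuous_id fun z => by
    simp [h', h, hinv]
  have e := hn (0 + 2 * Real.pi * I)
  simp only [Function.comp_apply, id, hd, add_int_mul_of_add hd'] at e
  have e0 := hn 0
  simp only [Function.comp_apply, id] at e0
  have : ((d * d' : ℤ) : ℂ) * (2 * Real.pi * I) = 1 * (2 * Real.pi * I) := by
    push_cast
    linear_combination e - e0
  have hdd : d * d' = 1 := by exact_mod_cast mul_right_cancel₀ two_pi_I_ne_zero this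
  exact Int.isUnit_iff.1 (IsUnit.of_mul_eq_one _ hdd)

/-- A continuous lift of degree `d` that commutes with translations along the imaginary axis up to
a constant multiplies the translation length by `d`. -/
theorem translation_eq_of_degree {H : ℂ → ℂ} (hH : Continuous H) {d : ℤ} {α : ℝ} {c : ℂ}
    (hd : ∀ z, H (z + 2 * Real.pi * I) = H z + d * (2 * Real.pi * I))
    (hα : ∀ z, H (z + α * I) = H z + c) : c = d * (α * I) := by
  -- `D` is continuous and periodic, hence bounded, whereas `D(nα) - D(0) = n(c - d·iα)`.
  let D : ℝ → ℂ := fun t => H (t * I) - d * (t * I)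
  have hper : Function.Periodic D (2 * Real.pi) := fun t => by
    have := hd (t * I)
    simp only [D]
    push_cast
    rw [add_mul, this]
    ring
  have hD : Continuous D := by fun_prop
  obtain ⟨C, hC⟩ := (hper.isBounded_of_continuous (by positivity) hD).exists_norm_le
  have hnc : ∀ n : ℕ, n * ‖c - d * (α * I)‖ ≤ C + C := fun n => by
    have e : (n : ℂ) * (c - d * (α * I)) = D (n * α) - D 0 := by
      have := add_int_mul_of_add hα n 0
      simp only [D]
      push_cast at this ⊢
      rw [zero_add] at this
      rw [mul_assoc, this, zero_mul]
      ring
    calc n * ‖c - d * (α * I)‖ = ‖D (n * α) - D 0‖ := by rw [← e, norm_mul, norm_natCast]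
      _ ≤ _ := (norm_sub_le _ _).trans (add_le_add (hC _ ⟨_, rfl⟩) (hC _ ⟨_, rfl⟩))
  rw [← sub_eq_zero, ← norm_eq_zero]
  by_contra hne
  have hpos : 0 < ‖c - d * (α * I)‖ := (norm_nonneg _).lt_of_ne' hne
  obtain ⟨n, hn⟩ := exists_nat_gt ((C + C) / ‖c - d * (α * I)‖)
  exact absurd (hnc n) (not_le.2 ((div_lt_iff₀ hpos).1 hn))

theorem rotation_eq_or_eq_inv_of_semiconj {k k' : ℂ → ℂ} (hk : Continuous k)
    (hk' : Continuous k') (hl : ∀ z, k' (k z) = z) (hr : ∀ z, k (k' z) = z) (h0 : k 0 = 0)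
    {μ ν : ℂ} (hμ : ‖μ‖ = 1) (hν : ‖ν‖ = 1) (hsemi : ∀ z, k (ν * z) = μ * k z) :
    ν = μ ∨ ν = μ⁻¹ := by
  have h0' : k' 0 = 0 := by rw [← h0, hl, h0]
  have hk0 : ∀ z, z ≠ 0 → k z ≠ 0 := fun z hz e => hz (by rw [← hl z, e, h0'])
  have hk'0 : ∀ z, z ≠ 0 → k' z ≠ 0 := fun z hz e => hz (by rw [← hr z, e, h0])
  obtain ⟨α, rfl⟩ := norm_eq_one_iff ν |>.1 hν
  obtain ⟨H, hH, h⟩ := exists_lift_exp hk hk0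
  obtain ⟨d, hd⟩ := exists_degree hH h
  have hμ0 : μ ≠ 0 := norm_pos_iff.1 (by rw [hμ]; exact one_pos)
  -- Both sides exponentiate to `μ · k(exp z)`, by the semiconjugacy.
  obtain ⟨n, hn⟩ := exists_eq_add_of_exp_eq (F := fun z => H (z + α * I))
    (G := fun z => H z + log μ) (by fun_prop) (by fun_prop) fun z => by
      rw [h, exp_add, exp_add, exp_log hμ0, h, mul_comm, hsemi, mul_comm]
  have hc := translation_eq_of_degree hH hd (c := log μ + n * (2 * Real.pi * I)) fun z => by
    rw [hn, add_assoc]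
  have hexp : μ = exp (d * (α * I)) := by
    rw [← hc, exp_add, exp_log hμ0, exp_int_mul_two_pi_mul_I, mul_one]
  rcases degree_eq_one_or_neg_one hk' hk'0 hl hH h hd with rfl | rfl
  · left
    simp [hexp]
  · right
    simp [hexp, exp_neg]

theorem exists_restrict {h : OnePoint ℂ → OnePoint ℂ} (hc : Continuous h)
    (hi : ∀ z : ℂ, h z ≠ ∞) : ∃ k : ℂ → ℂ, Continuous k ∧ ∀ z : ℂ, h z = k z := by
  choose k hk using fun z => OnePoint.ne_infty_iff_exists.1 (hi z)
  refine ⟨k, ?_, fun z => (hk z).symm⟩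
  rw [(isOpenEmbedding_coe (X := ℂ)).isEmbedding.continuous_iff]
  exact (hc.comp continuous_coe).congr fun z => (hk z).symm

theorem rotation_eq_or_eq_inv_of_fixed {μ ν : ℂ} (hμ : ‖μ‖ = 1) (hν : ‖ν‖ = 1)
    (h : OnePoint ℂ ≃ₜ OnePoint ℂ) (hh : ∀ z, h (scaling ν z) = scaling μ (h z))
    (hinf : h ∞ = ∞) (h0 : h ((0 : ℂ) : OnePoint ℂ) = ((0 : ℂ) : OnePoint ℂ)) :
    ν = μ ∨ ν = μ⁻¹ := by
  have hinf' : h.symm ∞ = ∞ := by rw [h.symm_apply_eq, hinf]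
  obtain ⟨k, hk, hhk⟩ := exists_restrict h.continuous fun z e =>
    coe_ne_infty z (h.injective (e.trans hinf.symm))
  obtain ⟨k', hk', hhk'⟩ := exists_restrict h.symm.continuous fun z e =>
    coe_ne_infty z (h.symm.injective (e.trans hinf'.symm))
  refine rotation_eq_or_eq_inv_of_semiconj hk hk' (fun z => ?_) (fun z => ?_) ?_ hμ hν fun z => ?_
  · rw [← OnePoint.coe_eq_coe, ← hhk', ← hhk, h.symm_apply_apply]
  · rw [← OnePoint.coe_eq_coe, ← hhk, ← hhk', h.apply_symm_apply]
  · rw [← OnePoint.coe_eq_coe, ← hhk, h0]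
  · have := hh z
    rw [hhk] at this
    simpa only [scaling, map_some, hhk, OnePoint.coe_eq_coe] using this

theorem scaling_eq_self_iff {μ : ℂ} (hμ : μ ≠ 1) (z : OnePoint ℂ) :
    scaling μ z = z ↔ z = ∞ ∨ z = ((0 : ℂ) : OnePoint ℂ) := by
  induction z using OnePoint.rec with
  | infty => simp [scaling]
  | coe w => simp [scaling, mul_left_eq_self₀, hμ]

theorem eq_or_eq_inv_of_topConj_scaling {μ ν : ℂ} (hμ : ‖μ‖ = 1) (hν : ‖ν‖ = 1) (hμ1 : μ ≠ 1)
    (h : TopConj (scaling μ) (scaling ν)) : ν = μ ∨ ν = μ⁻¹ := by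
  obtain ⟨h, hh⟩ := h
  have hh' : ∀ z, h (scaling ν z) = scaling μ (h z) := fun z => by rw [hh, h.apply_symm_apply]
  have hμ0 : μ ≠ 0 := norm_pos_iff.1 (by rw [hμ]; exact one_pos)
  -- Only `μ ≠ 1` is needed: `ν` may still be `1`, but `0` and `∞` are fixed by `scaling ν` in any
  -- case.
  have hfix : ∀ z, scaling ν z = z → h z = ∞ ∨ h z = ((0 : ℂ) : OnePoint ℂ) := fun z hz => by
    rw [← scaling_eq_self_iff hμ1, ← hh', hz]
  have hne : h ∞ ≠ h ((0 : ℂ) : OnePoint ℂ) := h.injective.ne (infty_ne_coe 0)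
  rcases hfix ∞ rfl with hi | hi <;>
    rcases hfix ((0 : ℂ) : OnePoint ℂ) (by simp [scaling]) with h0 | h0
  · exact absurd (hi.trans h0.symm) hne
  · exact rotation_eq_or_eq_inv_of_fixed hμ hν h hh' hi h0
  -- Here `h` swaps `0` and `∞`; composing with the inversion fixes both and replaces `μ` by `μ⁻¹`.
  · have := rotation_eq_or_eq_inv_of_fixed (μ := μ⁻¹) (by rw [norm_inv, hμ, inv_one]) hν
      (h.trans sphereInvHomeomorph)
      (fun z => by simp [hh', sphereInv_scaling hμ0]) (by simp [hi]) (by simp [h0])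
    rw [inv_inv] at this
    exact this.symm
  · exact absurd (hi.trans h0.symm) hne

theorem corollary1 (f : OnePoint ℂ → OnePoint ℂ) (hf : IsMobius f) :
    (IsHyperbolic f ∨ IsLoxodromic f → TopConj f (scaling 2)) ∧
    (IsElliptic f →
      ∃ μ : ℂ, ‖μ‖ = 1 ∧ TopConj f (scaling μ) ∧
        ∀ ν : ℂ, ‖ν‖ = 1 →
          (TopConj f (scaling ν) ↔ ν = μ ∨ ν = (starRingEnd ℂ) μ)) ∧
    (IsParabolic f → TopConj f shift) := by
  refine ⟨?_, ?_, fun h => h.topConj⟩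
  · rintro (⟨μ, h0, h1, h2, h⟩ | ⟨μ, hr, h1, h⟩)
    · refine h.topConj.trans (topConj_scaling_two (by exact_mod_cast h0) ?_)
      rw [norm_real, Real.norm_eq_abs]
      exact fun e => (eq_or_eq_neg_of_abs_eq e).elim h1 h2
    · exact h.topConj.trans (topConj_scaling_two (fun e => hr ⟨0, by simp [e]⟩) h1)
  · rintro ⟨μ, hμ, hμ1, h⟩
    refine ⟨μ, hμ, h.topConj, fun ν hν => ⟨fun h' => ?_, ?_⟩⟩
    · rw [← inv_eq_conj hμ]
      exact eq_or_eq_inv_of_topConj_scaling hμ hν hμ1 (h.topConj.symm.trans h')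
    · rintro (rfl | rfl)
      · exact h.topConj
      · exact h.topConj.trans (topConj_scaling_conj μ)
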